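/- Let $(M,g)$ be a connected (Hausdorff) smooth Riemannian manifold without boundary, let $L$ be a compact connected smooth manifold without boundary having at least two points, and let $i\colon L\to M$ be a smooth embedding (a smooth immersion that is a homeomorphism onto its image); identify $L$ with $i(L)\subset M$. Let $d_M$ be the Riemannian distance of $(M,g)$, i.e. the infimum of the lengths of $C^1$ curves in $M$ joining two points, and let $d_L$ be the Riemannian distance of $L$ with respect to the induced metric $i^{*}g$. Define the embedding constant of $L$ by \[ \operatorname{emb}(L):=\sup\left\{\frac{d_L(p,q)}{d_M(p,q)}\ \middle|\ p,q\in L,\ p\neq q\right\}\in[0,\infty]. \] Then $1\le \operatorname{emb}(L)<\infty$. -/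

import Mathlib

open Bundle
open scoped Manifold ContDiff ENNReal

noncomputable section

/-- The metric induced on `L` by a map `i : L → M` into a Riemannian manifold `(M, g)`, that is, the
pullback `(i^* g)_p (v, w) = g_{i p} (di_p v, di_p w)`. -/
def inducedMetric (m n : ℕ)
    {M : Type*} [TopologicalSpace M] [ChartedSpace (EuclideanSpace ℝ (Fin n)) M]
    [RiemannianBundle (fun x : M => TangentSpace (𝓡 n) x)]
    {L : Type*} [TopologicalSpace L] [ChartedSpace (EuclideanSpace ℝ (Fin m)) L]
    (i : L → M) (p : L) (v w : TangentSpace (𝓡 m) p) : ℝ :=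
  inner ℝ (mfderiv (𝓡 m) (𝓡 n) i p v) (mfderiv (𝓡 m) (𝓡 n) i p w)

/-- The distance `d_L` on `L` with respect to the induced metric: the infimum of the lengths, for
the norm `|v| = √((i^* g) (v, v))` on the tangent spaces of `L`, of the `C^1` paths in `L` which
join the two points. -/
def inducedEDist (m n : ℕ)
    {M : Type*} [TopologicalSpace M] [ChartedSpace (EuclideanSpace ℝ (Fin n)) M]
    [RiemannianBundle (fun x : M => TangentSpace (𝓡 n) x)]
    {L : Type*} [TopologicalSpace L] [ChartedSpace (EuclideanSpace ℝ (Fin m)) L]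
    (i : L → M) (p q : L) : ℝ≥0∞ :=
  letI : ∀ x : L, ENorm (TangentSpace (𝓡 m) x) :=
    fun x => ⟨fun v => ENNReal.ofReal (Real.sqrt (inducedMetric m n i x v v))⟩
  Manifold.riemannianEDist (𝓡 m) p q

/-- The embedding constant
`emb(L) = sup { d_L (p, q) / d_M (i p, i q) | p, q ∈ L, p ≠ q } ∈ [0, ∞]`,
where `d_M` is the Riemannian distance of `M`. -/
def embeddingConstant (m n : ℕ)
    {M : Type*} [TopologicalSpace M] [ChartedSpace (EuclideanSpace ℝ (Fin n)) M]
    [RiemannianBundle (fun x : M => TangentSpace (𝓡 n) x)]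
    {L : Type*} [TopologicalSpace L] [ChartedSpace (EuclideanSpace ℝ (Fin m)) L]
    (i : L → M) : ℝ≥0∞ :=
  sSup {r : ℝ≥0∞ | ∃ p q : L, p ≠ q ∧
    r = inducedEDist m n i p q / Manifold.riemannianEDist (𝓡 n) (i p) (i q)}

end

/-! The lower bound holds because `i` carries a `C^1` path in `L` to a path in `M` of the same
length, so `d_M ≤ d_L`. For the upper bound, `d_L / d_M` is bounded near each point `(x, y)` of `L ×
L`, and compactness makes the bound uniform.

Off the diagonal, `d_L` is finite and locally bounded, while `d_M` stays away from zero since `i` is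
injective. On the diagonal, straight segments in a chart `φ` of `L` give `d_L ≤ C |φ p - φ q|`
(`eventually_inducedEDist_le_edist_chart`). By the normal form of an immersion, `φ` is locally a
`C^1` function of the image point in `M`, and charts of `M` are locally Lipschitz for `d_M`; hence
`|φ p - φ q| ≤ C' d_M` (`eventually_edist_domChart_le_riemannianEDist`). -/

open Set MeasureTheory Filter
open scoped Topology NNReal

/-! ### The induced distance on `L` -/

section InducedDistance

variable {m n : ℕ}
  {M : Type*} [TopologicalSpace M] [ChartedSpace (EuclideanSpace ℝ (Fin n)) M]
  [RiemannianBundle (fun x : M => TangentSpace (𝓡 n) x)]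
  {L : Type*} [TopologicalSpace L] [ChartedSpace (EuclideanSpace ℝ (Fin m)) L]

/-- The extended norm on the tangent spaces of `L` given by the metric induced by `i`. -/
@[reducible]
noncomputable def inducedENorm (m n : ℕ)
    {M : Type*} [TopologicalSpace M] [ChartedSpace (EuclideanSpace ℝ (Fin n)) M]
    [RiemannianBundle (fun x : M => TangentSpace (𝓡 n) x)]
    {L : Type*} [TopologicalSpace L] [ChartedSpace (EuclideanSpace ℝ (Fin m)) L]
    (i : L → M) (x : L) : ENorm (TangentSpace (𝓡 m) x) :=
  ⟨fun v => ENNReal.ofReal (Real.sqrt (inducedMetric m n i x v v))⟩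

lemma sqrt_inducedMetric_eq_enorm (i : L → M) (x : L) (v : TangentSpace (𝓡 m) x) :
    ENNReal.ofReal (Real.sqrt (inducedMetric m n i x v v)) =
      ‖mfderiv (𝓡 m) (𝓡 n) i x v‖ₑ := by
  rw [inducedMetric, ← norm_eq_sqrt_real_inner, ofReal_norm]

/-- Homogeneity is what reparametrization of paths needs; symmetry and the triangle inequality for
`d_L` rest on it. -/
lemma inducedENorm_smul (i : L → M) (x : L) :
    letI := inducedENorm m n i x
    ENormSMulClass ℝ (TangentSpace (𝓡 m) x) := by
  let := inducedENorm m n i x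
  refine ⟨fun c v => ?_⟩
  change ENNReal.ofReal (Real.sqrt (inducedMetric m n i x (c • v) (c • v))) =
    ‖c‖ₑ * ENNReal.ofReal (Real.sqrt (inducedMetric m n i x v v))
  rw [sqrt_inducedMetric_eq_enorm, sqrt_inducedMetric_eq_enorm, map_smul, enorm_smul]

/-- By the chain rule the two speeds agree at every interior time. -/
lemma pathELength_inducedENorm_eq {i : L → M} {γ : ℝ → L} {a b : ℝ}
    (hi : MDifferentiable (𝓡 m) (𝓡 n) i)
    (hγ : MDifferentiableOn 𝓘(ℝ, ℝ) (𝓡 m) γ (Icc a b)) :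
    letI := inducedENorm m n i
    Manifold.pathELength (𝓡 m) γ a b = Manifold.pathELength (𝓡 n) (i ∘ γ) a b := by
  let : ∀ x, ENorm (TangentSpace (𝓡 m) x) := inducedENorm m n i
  rw [Manifold.pathELength_eq_lintegral_mfderiv_Ioo, Manifold.pathELength_eq_lintegral_mfderiv_Ioo]
  refine setLIntegral_congr_fun measurableSet_Ioo fun t ht => ?_
  have hγt : MDifferentiableAt 𝓘(ℝ, ℝ) (𝓡 m) γ t :=
    (hγ t ⟨ht.1.le, ht.2.le⟩).mdifferentiableAt (Icc_mem_nhds ht.1 ht.2)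
  have h := mfderiv_comp t (hi (γ t)) hγt
  change ENNReal.ofReal (Real.sqrt (inducedMetric m n i (γ t) _ _)) = _
  rw [sqrt_inducedMetric_eq_enorm, h]
  rfl

lemma inducedEDist_le_pathELength {i : L → M} {γ : ℝ → L} {a b : ℝ} {p q : L}
    (hi : MDifferentiable (𝓡 m) (𝓡 n) i)
    (hγ : ContMDiffOn 𝓘(ℝ, ℝ) (𝓡 m) 1 γ (Icc a b)) (ha : γ a = p) (hb : γ b = q) (hab : a ≤ b) :
    inducedEDist m n i p q ≤ Manifold.pathELength (𝓡 n) (i ∘ γ) a b := by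
  let : ∀ x, ENorm (TangentSpace (𝓡 m) x) := inducedENorm m n i
  have := fun x => inducedENorm_smul (m := m) (n := n) i x
  rw [← pathELength_inducedENorm_eq hi (hγ.mdifferentiableOn one_ne_zero)]
  exact Manifold.riemannianEDist_le_pathELength hγ ha hb hab

lemma inducedEDist_comm (i : L → M) (p q : L) :
    inducedEDist m n i p q = inducedEDist m n i q p := by
  let : ∀ x, ENorm (TangentSpace (𝓡 m) x) := inducedENorm m n i
  have := fun x => inducedENorm_smul (m := m) (n := n) i x
  exact Manifold.riemannianEDist_comm

lemma inducedEDist_triangle (i : L → M) (p q r : L) :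
    inducedEDist m n i p r ≤ inducedEDist m n i p q + inducedEDist m n i q r := by
  let : ∀ x, ENorm (TangentSpace (𝓡 m) x) := inducedENorm m n i
  have := fun x => inducedENorm_smul (m := m) (n := n) i x
  exact Manifold.riemannianEDist_triangle

lemma riemannianEDist_le_inducedEDist {i : L → M} (hi : ContMDiff (𝓡 m) (𝓡 n) 1 i) (p q : L) :
    Manifold.riemannianEDist (𝓡 n) (i p) (i q) ≤ inducedEDist m n i p q := by
  refine le_of_forall_gt fun r hr => ?_
  let : ∀ x, ENorm (TangentSpace (𝓡 m) x) := inducedENorm m n i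
  have := fun x => inducedENorm_smul (m := m) (n := n) i x
  obtain ⟨γ, h0, h1, hγ, hr⟩ := Manifold.exists_lt_of_riemannianEDist_lt (I := 𝓡 m) hr
  rw [pathELength_inducedENorm_eq (hi.mdifferentiable one_ne_zero)
    (hγ.mdifferentiableOn one_ne_zero)] at hr
  refine lt_of_le_of_lt ?_ hr
  exact Manifold.riemannianEDist_le_pathELength (hi.comp_contMDiffOn hγ) (by simp [h0])
    (by simp [h1]) zero_le_one

end InducedDistance

/-! ### Comparison of Riemannian and chart distances -/

section ChartEstimates

variable {E : Type*} [NormedAddCommGroup E] [NormedSpace ℝ E]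
  {H : Type*} [TopologicalSpace H] (I : ModelWithCorners ℝ E H)
  {M : Type*} [TopologicalSpace M] [ChartedSpace H M]
  [RiemannianBundle (fun x : M => TangentSpace I x)]
  [IsManifold I 1 M] [IsContinuousRiemannianBundle E (fun x : M => TangentSpace I x)]

/-- Near any point, the derivative of the extended chart is bounded for the Riemannian norm. -/
lemma eventually_enorm_mfderiv_extChartAt_apply_le (x : M) :
    ∃ C > (0 : ℝ≥0), ∀ᶠ y in 𝓝 x, ∀ v : TangentSpace I y,
      enorm (E := E) (mfderiv I 𝓘(ℝ, E) (extChartAt I x) y v) ≤ C * ‖v‖ₑ := by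
  obtain ⟨C, C_pos, hC⟩ :=
    eventually_norm_trivializationAt_lt E (fun x : M => TangentSpace I x) x
  lift C to ℝ≥0 using C_pos.le
  refine ⟨C, by exact_mod_cast C_pos, ?_⟩
  filter_upwards [hC, chart_source_mem_nhds H x] with y hy h'y v
  have h := ContinuousLinearMap.le_of_opNorm_le _ hy.le v
  rw [TangentBundle.continuousLinearMapAt_trivializationAt h'y] at h
  simp only [enorm]
  exact_mod_cast h

/-- Near any point, the derivative of the inverse of the extended chart is bounded for the
Riemannian norm. -/
lemma eventually_enorm_mfderivWithin_symm_extChartAt_apply_le (x : M) :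
    ∃ C : ℝ≥0, ∀ᶠ y in 𝓝 x, ∀ v : E,
      enorm (E := TangentSpace I y)
        (mfderivWithin 𝓘(ℝ, E) I (extChartAt I x).symm (range I) (extChartAt I x y) v) ≤
          C * ‖v‖ₑ := by
  obtain ⟨C, C_pos, hC⟩ :=
    eventually_norm_symmL_trivializationAt_lt E (fun x : M => TangentSpace I x) x
  lift C to ℝ≥0 using C_pos.le
  refine ⟨C, ?_⟩
  filter_upwards [hC, chart_source_mem_nhds H x] with y hy h'y v
  have h := ContinuousLinearMap.le_of_opNorm_le _ hy.le v
  rw [TangentBundle.symmL_trivializationAt h'y] at h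
  simp only [enorm]
  exact_mod_cast h

omit [IsContinuousRiemannianBundle E fun x : M => TangentSpace I x] in
/-- If a path stays in a set where the derivative of the extended chart is bounded by `C`, the
displacement in the chart is at most `C` times the length of the path. -/
lemma edist_extChartAt_le_mul_pathELength {x : M} {C : ℝ≥0} {u : Set M}
    (hu : u ⊆ {y | ∀ v : TangentSpace I y,
      enorm (E := E) (mfderiv I 𝓘(ℝ, E) (extChartAt I x) y v) ≤ C * ‖v‖ₑ})
    (hux : u ⊆ (chartAt H x).source) {γ : ℝ → M} (hγ : ContMDiff 𝓘(ℝ, ℝ) I 1 γ)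
    (hγu : ∀ t ∈ Icc (0 : ℝ) 1, γ t ∈ u) :
    edist (extChartAt I x (γ 0)) (extChartAt I x (γ 1)) ≤ C * Manifold.pathELength I γ 0 1 := by
  let γ' := extChartAt I x ∘ γ
  have hC : ContMDiffOn 𝓘(ℝ, ℝ) 𝓘(ℝ, E) 1 γ' (Icc 0 1) :=
    contMDiffOn_extChartAt.comp (I' := I) (t := (chartAt H x).source)
      hγ.contMDiffOn (fun t' ht' ↦ hux (hγu _ ht'))
  rw [edist_comm, edist_eq_enorm_sub]
  calc
    ‖γ' 1 - γ' 0‖ₑ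
    _ ≤ ∫⁻ t' in Icc 0 1, ‖derivWithin γ' (Icc 0 1) t'‖ₑ := by
      apply enorm_sub_le_lintegral_derivWithin_Icc_of_contDiffOn_Icc _ zero_le_one
      rwa [← contMDiffOn_iff_contDiffOn]
    _ = ∫⁻ t' in Icc 0 1, enorm (E := E) (mfderiv[Icc 0 1] γ' t' 1) := by
      simp_rw [← fderivWithin_derivWithin, mfderivWithin_eq_fderivWithin]
      rfl
    _ ≤ ∫⁻ t' in Icc 0 1, C * ‖mfderiv[Icc 0 1] γ t' 1‖ₑ := by
      apply setLIntegral_mono' measurableSet_Icc (fun t' ht' ↦ ?_)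
      have : mfderiv[Icc 0 1] γ' t' =
          (mfderiv% (extChartAt I x) (γ t')) ∘L (mfderiv[Icc 0 1] γ t') := by
        apply mfderiv_comp_mfderivWithin
        · exact mdifferentiableAt_extChartAt (hux (hγu _ ht'))
        · exact (hγ.mdifferentiable one_ne_zero).mdifferentiableOn _ ht'
        · rw [uniqueMDiffWithinAt_iff_uniqueDiffWithinAt]
          exact uniqueDiffOn_Icc zero_lt_one _ ht'
      have : mfderiv[Icc 0 1] γ' t' 1 =
          (mfderiv% (extChartAt I x) (γ t')) (mfderiv[Icc 0 1] γ t' 1) :=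
        congr($this 1)
      rw [this]
      exact hu (hγu _ ht') _
    _ = C * Manifold.pathELength I γ 0 1 := by
      rw [lintegral_const_mul' _ _ ENNReal.coe_ne_top,
          Manifold.pathELength_eq_lintegral_mfderivWithin_Icc]

omit [IsManifold I 1 M] [IsContinuousRiemannianBundle E fun x : M => TangentSpace I x] in
lemma riemannianEDist_apply_le_pathELength {γ : ℝ → M} (hγ : ContMDiff 𝓘(ℝ, ℝ) I 1 γ)
    {t : ℝ} (ht : t ∈ Icc (0 : ℝ) 1) :
    Manifold.riemannianEDist I (γ 0) (γ t) ≤ Manifold.pathELength I γ 0 1 :=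
  (Manifold.riemannianEDist_le_pathELength hγ.contMDiffOn rfl rfl ht.1).trans
    (Manifold.pathELength_mono le_rfl ht.2)

/-- Near any point, the extended chart is Lipschitz for the Riemannian distance. -/
lemma eventually_edist_extChartAt_le_riemannianEDist [RegularSpace M] (x : M) :
    ∃ C : ℝ≥0, ∀ᶠ p : M × M in 𝓝 (x, x),
      edist (extChartAt I x p.1) (extChartAt I x p.2) ≤
        C * Manifold.riemannianEDist I p.1 p.2 := by
  obtain ⟨C, C_pos, hC⟩ := eventually_enorm_mfderiv_extChartAt_apply_le I x
  obtain ⟨c, c_pos, hc⟩ := setOfPred_riemannianEDist_lt_subset_nhds I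
    (inter_mem hC (chart_source_mem_nhds H x))
  refine ⟨C, ?_⟩
  -- Endpoints within `c / 3` of `x` are less than `2c / 3` apart, so a nearly shortest path between
  -- them stays in the `c`-ball, where the derivative bound holds.
  have hc3 : (0 : ℝ≥0∞) < ((c / 3 : ℝ≥0) : ℝ≥0∞) := by
    exact_mod_cast div_pos c_pos three_pos
  have hnear := eventually_riemannianEDist_lt I x hc3
  rw [nhds_prod_eq]
  filter_upwards [hnear.prod_mk hnear] with p ⟨h1, h2⟩
  -- Dividing by `C > 0` isolates the infimum over paths, which can then be tested one path at a
  -- time.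
  rw [mul_comm, ← ENNReal.div_le_iff_le_mul (.inl (by simpa using C_pos.ne')) (.inl (by simp))]
  have h12 : Manifold.riemannianEDist I p.1 p.2 < (c / 3 : ℝ≥0) + (c / 3 : ℝ≥0) :=
    (Manifold.riemannianEDist_triangle (y := x)).trans_lt
      (ENNReal.add_lt_add (by rwa [Manifold.riemannianEDist_comm]) h2)
  refine le_of_forall_gt fun r hr => ?_
  obtain ⟨γ, h0, h1', hγ, hlen, -⟩ := Manifold.exists_lt_locally_constant_of_riemannianEDist_lt
    (lt_min hr h12) zero_lt_one
  refine lt_of_le_of_lt ?_ (hlen.trans_le (min_le_left _ _))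
  rw [ENNReal.div_le_iff_le_mul (.inl (by simpa using C_pos.ne')) (.inl (by simp)), mul_comm,
    ← h0, ← h1']
  refine edist_extChartAt_le_mul_pathELength I (fun y hy => (hc hy).1) (fun y hy => (hc hy).2) hγ
    fun t ht => ?_
  have ht' := riemannianEDist_apply_le_pathELength I hγ ht
  rw [h0] at ht'
  calc Manifold.riemannianEDist I x (γ t)
    _ ≤ Manifold.riemannianEDist I x p.1 + Manifold.riemannianEDist I p.1 (γ t) :=
      Manifold.riemannianEDist_triangle
    _ < (c / 3 : ℝ≥0) + ((c / 3 : ℝ≥0) + (c / 3 : ℝ≥0)) :=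
      ENNReal.add_lt_add h1 (ht'.trans_lt (hlen.trans_le (min_le_right _ _)))
    _ = c := by
      norm_cast
      ring

/-- A `C^1` map from a normed space to a manifold increases the length of short segments by at most
a bounded factor. -/
lemma eventually_pathELength_comp_lineMap_le {F : Type*} [NormedAddCommGroup F] [NormedSpace ℝ F]
    {f : F → M} {z : F} (hf : ContMDiffAt 𝓘(ℝ, F) I 1 f z) :
    ∃ C : ℝ≥0, ∀ᶠ p : F × F in 𝓝 (z, z),
      Manifold.pathELength I (f ∘ ContinuousAffineMap.lineMap (R := ℝ) p.1 p.2) 0 1 ≤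
        C * edist p.1 p.2 := by
  obtain ⟨C₁, hC₁⟩ := eventually_enorm_mfderivWithin_symm_extChartAt_apply_le I (f z)
  set e := extChartAt I (f z)
  let w : F → E := e ∘ f
  have hw : ContDiffAt ℝ 1 w z := by
    rw [← contMDiffAt_iff_contDiffAt]
    exact contMDiffAt_extChartAt.comp z hf
  have hC₂ : ∀ᶠ y in 𝓝 z, ‖fderiv ℝ w y‖ < ‖fderiv ℝ w z‖ + 1 :=
    ((hw.continuousAt_fderiv one_ne_zero).norm).eventually_lt_const (by simp)
  have hsource : ∀ᶠ y in 𝓝 z, f y ∈ e.source :=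
    hf.continuousAt.eventually (extChartAt_source_mem_nhds (I := I) (f z))
  have hbound : ∀ᶠ y in 𝓝 z, MDifferentiableAt 𝓘(ℝ, F) I f y ∧ ∀ v : F,
      ‖mfderiv 𝓘(ℝ, F) I f y v‖ₑ ≤ (C₁ * (‖fderiv ℝ w z‖₊ + 1) : ℝ≥0) * ‖v‖ₑ := by
    filter_upwards [hC₂, hsource.eventually_nhds, hf.continuousAt.eventually hC₁,
      (contMDiffAt_iff_contMDiffAt_nhds (by simp)).1 hf, hw.eventually (by simp)]
      with y h2 hs h1 hfy hwy
    have hfd : MDifferentiableAt 𝓘(ℝ, F) I f y := hfy.mdifferentiableAt one_ne_zero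
    refine ⟨hfd, fun v => ?_⟩
    have hwd : MDifferentiableWithinAt 𝓘(ℝ, F) 𝓘(ℝ, E) w univ y :=
      (hwy.differentiableAt one_ne_zero).mdifferentiableAt.mdifferentiableWithinAt
    -- Near `y`, `f` is the inverse chart after its local expression `w`, so its derivative is
    -- controlled by the two bounds.
    have hcomp : mfderiv 𝓘(ℝ, F) I f y =
        (mfderivWithin 𝓘(ℝ, E) I e.symm (range I) (w y)) ∘L (fderiv ℝ w y) := by
      have hfe : f =ᶠ[𝓝 y] e.symm ∘ w := by
        filter_upwards [hs] with y' hy'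
        simp [w, e.left_inv hy']
      rw [hfe.mfderiv_eq, ← mfderivWithin_univ, mfderivWithin_comp (u := range I) y
        (mdifferentiableWithinAt_extChartAt_symm (e.map_source hs.self_of_nhds)) hwd
        (fun y' _ => by simp [w, e]) (uniqueMDiffWithinAt_univ _), mfderivWithin_univ,
        mfderiv_eq_fderiv]
      rfl
    have hR : ‖fderiv ℝ w y‖ₑ ≤ (‖fderiv ℝ w z‖₊ + 1 : ℝ≥0) := by
      simp only [enorm]
      exact_mod_cast h2.le
    rw [hcomp, ENNReal.coe_mul, mul_assoc]
    exact (h1 _).trans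
      (mul_le_mul' le_rfl ((ContinuousLinearMap.le_opENorm _ _).trans (mul_le_mul' hR le_rfl)))
  obtain ⟨r, r_pos, hr⟩ := Metric.eventually_nhds_iff_ball.1 hbound
  refine ⟨C₁ * (‖fderiv ℝ w z‖₊ + 1), ?_⟩
  rw [nhds_prod_eq]
  filter_upwards [prod_mem_prod (Metric.ball_mem_nhds z r_pos) (Metric.ball_mem_nhds z r_pos)]
    with p ⟨h1, h2⟩
  let η := ContinuousAffineMap.lineMap (R := ℝ) p.1 p.2
  have hη : ∀ t ∈ Icc (0 : ℝ) 1, η t ∈ Metric.ball z r := fun t ht => by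
    refine (convex_ball z r).segment_subset h1 h2 ?_
    rw [segment_eq_image_lineMap]
    exact ⟨t, ht, rfl⟩
  rw [← lintegral_fderiv_lineMap_eq_edist,
    Manifold.pathELength_eq_lintegral_mfderivWithin_Icc,
    ← lintegral_const_mul' _ _ ENNReal.coe_ne_top]
  refine setLIntegral_mono' measurableSet_Icc fun t ht => ?_
  have hcomp : mfderiv[Icc 0 1] (f ∘ η) t =
      (mfderiv 𝓘(ℝ, F) I f (η t)) ∘L (mfderiv[Icc 0 1] η t) := by
    apply mfderiv_comp_mfderivWithin
    · exact (hr _ (hη t ht)).1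
    · exact η.differentiableAt.mdifferentiableAt.mdifferentiableWithinAt
    · rw [uniqueMDiffWithinAt_iff_uniqueDiffWithinAt]
      exact uniqueDiffOn_Icc zero_lt_one _ ht
  have : mfderiv[Icc 0 1] (f ∘ η) t 1 =
      mfderiv 𝓘(ℝ, F) I f (η t) (mfderiv[Icc 0 1] η t 1) := congr($hcomp 1)
  rw [this, mfderivWithin_eq_fderivWithin]
  exact (hr _ (hη t ht)).2 _

end ChartEstimates

/-! ### Local and global bounds for the ratio -/

section EmbeddingConstant

variable {m n : ℕ}
  {M : Type*} [TopologicalSpace M] [ChartedSpace (EuclideanSpace ℝ (Fin n)) M]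
  [IsManifold (𝓡 n) ∞ M]
  [RiemannianBundle (fun x : M => TangentSpace (𝓡 n) x)]
  [IsContinuousRiemannianBundle (EuclideanSpace ℝ (Fin n)) (fun x : M => TangentSpace (𝓡 n) x)]
  {L : Type*} [TopologicalSpace L] [ChartedSpace (EuclideanSpace ℝ (Fin m)) L]
  [IsManifold (𝓡 m) ∞ L]

omit [IsManifold (𝓡 m) ∞ L] in
/-- Near any point, the induced distance is controlled by the distance in a chart. -/
lemma eventually_inducedEDist_le_edist_chart {i : L → M} (hi : ContMDiff (𝓡 m) (𝓡 n) ∞ i)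
    {φ : OpenPartialHomeomorph L (EuclideanSpace ℝ (Fin m))}
    (hφ : φ ∈ IsManifold.maximalAtlas (𝓡 m) ∞ L) {x : L} (hx : x ∈ φ.source) :
    ∃ C : ℝ≥0, ∀ᶠ p : L × L in 𝓝 (x, x),
      inducedEDist m n i p.1 p.2 ≤ C * edist (φ p.1) (φ p.2) := by
  have hsymm : ContMDiffOn (𝓡 m) (𝓡 m) ∞ φ.symm φ.target :=
    contMDiffOn_symm_of_mem_maximalAtlas hφ
  have htarget : φ.target ∈ 𝓝 (φ x) := φ.open_target.mem_nhds (φ.map_source hx)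
  have hf : ContMDiffAt (𝓡 m) (𝓡 n) 1 (i ∘ φ.symm) (φ x) :=
    ((hi.comp_contMDiffOn hsymm).contMDiffAt htarget).of_le (by simp)
  obtain ⟨C, hC⟩ := eventually_pathELength_comp_lineMap_le (𝓡 n) hf
  obtain ⟨r, r_pos, hr⟩ := Metric.mem_nhds_iff.1 htarget
  refine ⟨C, ?_⟩
  have hcont : ContinuousAt (Prod.map φ φ) (x, x) :=
    (φ.continuousAt hx).prodMap (φ.continuousAt hx)
  have hball : ∀ᶠ y in 𝓝 x, φ y ∈ Metric.ball (φ x) r ∧ y ∈ φ.source :=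
    ((φ.continuousAt hx).eventually (Metric.ball_mem_nhds _ r_pos)).and
      (φ.open_source.mem_nhds hx)
  filter_upwards [hcont.eventually hC, nhds_prod_eq (x := x) (y := x) ▸ hball.prod_mk hball]
    with p hp ⟨⟨h1, h1'⟩, h2, h2'⟩
  refine le_trans ?_ hp
  let η := ContinuousAffineMap.lineMap (R := ℝ) (φ p.1) (φ p.2)
  have hη : MapsTo η (Icc (0 : ℝ) 1) φ.target := fun t ht => by
    refine hr ((convex_ball _ r).segment_subset h1 h2 ?_)
    rw [segment_eq_image_lineMap]
    exact ⟨t, ht, rfl⟩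
  have hηs : ContMDiff 𝓘(ℝ, ℝ) (𝓡 m) 1 η := contMDiff_iff_contDiff.2 η.contDiff
  refine inducedEDist_le_pathELength (γ := φ.symm ∘ η) (hi.mdifferentiable (by simp))
    ((hsymm.of_le (by simp)).comp hηs.contMDiffOn hη) ?_ ?_ zero_le_one
  · simp [η, ContinuousAffineMap.coe_lineMap_eq, φ.left_inv h1']
  · simp [η, ContinuousAffineMap.coe_lineMap_eq, φ.left_inv h2']

omit [IsManifold (𝓡 m) ∞ L] in
/-- Near any point, the domain chart of an immersion is Lipschitz for the distance of the target. -/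
lemma eventually_edist_domChart_le_riemannianEDist [RegularSpace M] {i : L → M} {x : L}
    (hi : Manifold.IsImmersionAt (𝓡 m) (𝓡 n) ∞ i x) :
    ∃ C : ℝ≥0, ∀ᶠ p : L × L in 𝓝 (x, x),
      edist (hi.domChart p.1) (hi.domChart p.2) ≤
        C * Manifold.riemannianEDist (𝓡 n) (i p.1) (i p.2) := by
  obtain ⟨C, hC⟩ := eventually_edist_extChartAt_le_riemannianEDist (𝓡 n) (i x)
  let e := extChartAt (𝓡 n) (i x)
  let φ := hi.domChart
  let ψ := hi.codChart
  -- In the immersion charts `i` reads `u ↦ (u, 0)`; projecting to the first factor recovers `φ`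
  -- from `e ∘ i`.
  let G : EuclideanSpace ℝ (Fin n) → EuclideanSpace ℝ (Fin m) :=
    fun z => (hi.equiv.symm (ψ (e.symm z))).1
  have hix : i x ∈ e.source := mem_extChartAt_source (i x)
  have hG : ContDiffAt ℝ 1 G (e (i x)) := by
    have hψ : ContMDiffAt (𝓡 n) (𝓡 n) 1 ψ (e.symm (e (i x))) := by
      rw [e.left_inv hix]
      exact ((contMDiffOn_of_mem_maximalAtlas hi.codChart_mem_maximalAtlas).contMDiffAt
        (ψ.open_source.mem_nhds hi.mem_codChart_source)).of_le (by simp)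
    have he : ContMDiffAt (𝓡 n) (𝓡 n) 1 e.symm (e (i x)) :=
      ((contMDiffOn_extChartAt_symm (n := ∞) (i x)).contMDiffAt
        (extChartAt_target_mem_nhds (i x))).of_le (by simp)
    have h := contMDiffAt_iff_contDiffAt.1 (hψ.comp (e (i x)) he)
    exact contDiff_fst.contDiffAt.comp _ (hi.equiv.symm.contDiff.contDiffAt.comp _ h)
  have hGe : ∀ᶠ y in 𝓝 x, G (e (i y)) = φ y := by
    filter_upwards [hi.continuousAt.eventually (extChartAt_source_mem_nhds (I := 𝓡 n) (i x)),
      φ.open_source.mem_nhds hi.mem_domChart_source] with y h1 h2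
    have hy : φ y ∈ (φ.extend (𝓡 m)).target := by simpa using φ.map_source h2
    have h := hi.writtenInCharts hy
    have h' : ψ (i y) = hi.equiv (φ y, 0) := by
      simpa [φ.left_inv h2, φ, ψ] using h
    simp only [G]
    rw [e.left_inv h1, h']
    simp
  obtain ⟨K, t, ht, hK⟩ := hG.exists_lipschitzOnWith
  have hnear : ∀ᶠ y in 𝓝 x, e (i y) ∈ t ∧ G (e (i y)) = φ y :=
    (((continuousAt_extChartAt (I := 𝓡 n) (i x)).comp hi.continuousAt).eventually ht).and hGe
  refine ⟨K * C, ?_⟩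
  have hcont : ContinuousAt (Prod.map i i) (x, x) := hi.continuousAt.prodMap hi.continuousAt
  filter_upwards [hcont.eventually hC, nhds_prod_eq (x := x) (y := x) ▸ hnear.prod_mk hnear]
    with p hp ⟨⟨h1, h1'⟩, h2, h2'⟩
  change edist (φ p.1) (φ p.2) ≤ _
  rw [← h1', ← h2', ENNReal.coe_mul, mul_assoc]
  exact (hK h1 h2).trans (mul_le_mul' le_rfl hp)

/-- Points at finite distance from `p` form a nonempty clopen set, since nearby points are joined by
chart segments of finite length. -/
lemma inducedEDist_ne_top [PreconnectedSpace L] {i : L → M} (hi : ContMDiff (𝓡 m) (𝓡 n) ∞ i)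
    (p q : L) : inducedEDist m n i p q ≠ ⊤ := by
  have hloc : ∀ x : L, ∀ᶠ y in 𝓝 x, inducedEDist m n i x y < ⊤ := fun x => by
    obtain ⟨C, hC⟩ := eventually_inducedEDist_le_edist_chart hi
      (IsManifold.chart_mem_maximalAtlas (I := 𝓡 m) (n := ∞) x)
      (mem_chart_source (EuclideanSpace ℝ (Fin m)) x)
    filter_upwards [(Continuous.prodMk_right x).continuousAt.eventually hC] with y hy
    exact hy.trans_lt (ENNReal.mul_lt_top (by simp) (edist_lt_top _ _))
  have hclopen : IsClopen {y | inducedEDist m n i p y < ⊤} := by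
    refine ⟨isOpen_compl_iff.1 (isOpen_iff_mem_nhds.2 fun y hy => ?_),
      isOpen_iff_mem_nhds.2 fun y hy => ?_⟩
    · filter_upwards [hloc y] with z hz hpz
      refine hy ((inducedEDist_triangle i p z y).trans_lt (ENNReal.add_lt_top.2 ⟨hpz, ?_⟩))
      rwa [inducedEDist_comm]
    · filter_upwards [hloc y] with z hz
      exact (inducedEDist_triangle i p y z).trans_lt (ENNReal.add_lt_top.2 ⟨hy, hz⟩)
  have huniv := hclopen.eq_univ ⟨p, (hloc p).self_of_nhds⟩
  exact ne_of_lt (huniv ▸ mem_univ q : q ∈ {y | inducedEDist m n i p y < ⊤})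

lemma riemannianEDist_pos [T3Space M] {a b : M} (hab : a ≠ b) :
    0 < Manifold.riemannianEDist (𝓡 n) a b := by
  let _ : EMetricSpace M := EMetricSpace.ofRiemannianMetric (𝓡 n) M
  exact edist_pos.2 hab

lemma continuous_riemannianEDist [T3Space M] :
    Continuous fun p : M × M => Manifold.riemannianEDist (𝓡 n) p.1 p.2 := by
  let _ : EMetricSpace M := EMetricSpace.ofRiemannianMetric (𝓡 n) M
  exact continuous_edist

/-- For an embedding, the ratio of the induced distance and the distance of the target is locally
bounded on `L × L`. -/
lemma eventually_inducedEDist_le_riemannianEDist [PreconnectedSpace L] [T3Space M] {i : L → M}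
    (hi : Manifold.IsSmoothEmbedding (𝓡 m) (𝓡 n) ∞ i) (x y : L) :
    ∃ C : ℝ≥0, ∀ᶠ p : L × L in 𝓝 (x, y),
      inducedEDist m n i p.1 p.2 ≤ C * Manifold.riemannianEDist (𝓡 n) (i p.1) (i p.2) := by
  have hloc : ∀ x : L, ∃ C : ℝ≥0, ∀ᶠ p : L × L in 𝓝 (x, x),
      inducedEDist m n i p.1 p.2 ≤ C * edist (hi.isImmersion.isImmersionAt x |>.domChart p.1)
        (hi.isImmersion.isImmersionAt x |>.domChart p.2) := fun x =>
    eventually_inducedEDist_le_edist_chart hi.contMDiff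
      (hi.isImmersion.isImmersionAt x).domChart_mem_maximalAtlas
      (hi.isImmersion.isImmersionAt x).mem_domChart_source
  by_cases hxy : x = y
  · subst hxy
    obtain ⟨C₁, h₁⟩ := hloc x
    obtain ⟨C₂, h₂⟩ := eventually_edist_domChart_le_riemannianEDist
      (hi.isImmersion.isImmersionAt x)
    refine ⟨C₁ * C₂, ?_⟩
    filter_upwards [h₁, h₂] with p h1 h2
    rw [ENNReal.coe_mul, mul_assoc]
    exact h1.trans (mul_le_mul' le_rfl h2)
  · have hnear : ∀ x : L, ∀ᶠ y in 𝓝 x, inducedEDist m n i x y < 1 := fun x => by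
      obtain ⟨C, hC⟩ := hloc x
      set φ := (hi.isImmersion.isImmersionAt x).domChart
      have hφ : ContinuousAt φ x :=
        φ.continuousAt (hi.isImmersion.isImmersionAt x).mem_domChart_source
      have hlim : Tendsto (fun y => (C : ℝ≥0∞) * edist (φ x) (φ y)) (𝓝 x) (𝓝 0) := by
        have h := ENNReal.Tendsto.const_mul (a := (C : ℝ≥0∞)) (tendsto_const_nhds.edist hφ)
          (.inr ENNReal.coe_ne_top) (b := edist (φ x) (φ x))
        simpa using h
      filter_upwards [(Continuous.prodMk_right x).continuousAt.eventually hC,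
        hlim.eventually_lt_const one_pos] with y h1 h2
      exact h1.trans_lt h2
    have hpos := riemannianEDist_pos (n := n) (hi.isEmbedding.injective.ne hxy)
    obtain ⟨c, hc0, hc⟩ := ENNReal.lt_iff_exists_nnreal_btwn.1 hpos
    have hlower : ∀ᶠ p : L × L in 𝓝 (x, y),
        c < Manifold.riemannianEDist (𝓡 n) (i p.1) (i p.2) := by
      have hcont : Continuous fun p : L × L =>
          Manifold.riemannianEDist (𝓡 n) (i p.1) (i p.2) :=
        continuous_riemannianEDist.comp
          (hi.contMDiff.continuous.prodMap hi.contMDiff.continuous)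
      exact hcont.continuousAt.eventually_const_lt hc
    obtain ⟨D, hD⟩ := WithTop.ne_top_iff_exists.1 (inducedEDist_ne_top hi.contMDiff x y)
    -- The numerator bounds `d_L` through `x` and `y`, with `D = d_L(x, y)`; `c` bounds `d_M` from
    -- below.
    refine ⟨(1 + D + 1) / c, ?_⟩
    filter_upwards [hlower, nhds_prod_eq (x := x) (y := y) ▸ (hnear x).prod_mk (hnear y)]
      with p hp ⟨h1, h2⟩
    have hc0' : c ≠ 0 := by simpa using hc0.ne'
    calc inducedEDist m n i p.1 p.2
      _ ≤ inducedEDist m n i p.1 x + inducedEDist m n i x y + inducedEDist m n i y p.2 :=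
        (inducedEDist_triangle i p.1 y p.2).trans
          (add_le_add_left (inducedEDist_triangle i p.1 x y) _)
      _ ≤ 1 + D + 1 := by
        rw [inducedEDist_comm i p.1 x]
        exact add_le_add (add_le_add h1.le hD.ge) h2.le
      _ = ((1 + D + 1) / c : ℝ≥0) * c := by
        norm_cast
        field_simp
      _ ≤ _ := by gcongr

lemma exists_inducedEDist_le_riemannianEDist [CompactSpace L] [PreconnectedSpace L] [T3Space M]
    {i : L → M} (hi : Manifold.IsSmoothEmbedding (𝓡 m) (𝓡 n) ∞ i) :
    ∃ C : ℝ≥0, ∀ p : L × L,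
      inducedEDist m n i p.1 p.2 ≤ C * Manifold.riemannianEDist (𝓡 n) (i p.1) (i p.2) := by
  suffices h : ∃ C : ℝ≥0, ∀ p ∈ (univ : Set (L × L)),
      inducedEDist m n i p.1 p.2 ≤ C * Manifold.riemannianEDist (𝓡 n) (i p.1) (i p.2) by
    simpa using h
  refine isCompact_univ.induction_on (p := fun s => ∃ C : ℝ≥0, ∀ p : L × L, p ∈ s →
    inducedEDist m n i p.1 p.2 ≤ C * Manifold.riemannianEDist (𝓡 n) (i p.1) (i p.2))
    ⟨0, by simp⟩ ?_ ?_ ?_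
  · rintro s t hst ⟨C, hC⟩
    exact ⟨C, fun p hp => hC p (hst hp)⟩
  · rintro s t ⟨C, hC⟩ ⟨D, hD⟩
    refine ⟨max C D, ?_⟩
    rintro p (hp | hp)
    · exact (hC p hp).trans (by gcongr; exact le_max_left _ _)
    · exact (hD p hp).trans (by gcongr; exact le_max_right _ _)
  · rintro ⟨x, y⟩ -
    obtain ⟨C, hC⟩ := eventually_inducedEDist_le_riemannianEDist hi x y
    exact ⟨_, mem_nhdsWithin_of_mem_nhds hC, C, fun p hp => hp⟩

end EmbeddingConstant

theorem mainTheorem7 (m n : ℕ)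
    {M : Type*} [TopologicalSpace M] [T2Space M] [ConnectedSpace M]
    [ChartedSpace (EuclideanSpace ℝ (Fin n)) M] [IsManifold (𝓡 n) ∞ M]
    [RiemannianBundle (fun x : M => TangentSpace (𝓡 n) x)]
    [IsContMDiffRiemannianBundle (𝓡 n) ∞ (EuclideanSpace ℝ (Fin n))
      (fun x : M => TangentSpace (𝓡 n) x)]
    {L : Type*} [TopologicalSpace L] [CompactSpace L] [ConnectedSpace L] [Nontrivial L]
    [ChartedSpace (EuclideanSpace ℝ (Fin m)) L] [IsManifold (𝓡 m) ∞ L]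
    (i : L → M) (hi : Manifold.IsSmoothEmbedding (𝓡 m) (𝓡 n) ∞ i) :
    1 ≤ embeddingConstant m n i ∧ embeddingConstant m n i < ⊤ := by
  have : LocallyCompactSpace M := ChartedSpace.locallyCompactSpace (EuclideanSpace ℝ (Fin n)) M
  have : T3Space M := inferInstance
  have : IsContinuousRiemannianBundle (EuclideanSpace ℝ (Fin n))
      (fun x : M => TangentSpace (𝓡 n) x) := by
    obtain ⟨g, hg, h⟩ := IsContMDiffRiemannianBundle.exists_contMDiff (IB := 𝓡 n) (n := ∞)
      (F := EuclideanSpace ℝ (Fin n)) (E := fun x : M => TangentSpace (𝓡 n) x)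
    exact ⟨g, hg.continuous, h⟩
  constructor
  · obtain ⟨p, q, hpq⟩ := exists_pair_ne L
    have hle := riemannianEDist_le_inducedEDist (hi.contMDiff.of_le (by simp)) p q
    refine le_trans ?_ (le_sSup ⟨p, q, hpq, rfl⟩)
    -- The denominator is positive by injectivity, and finite because `d_M ≤ d_L < ⊤`.
    rw [ENNReal.le_div_iff_mul_le
      (.inl (riemannianEDist_pos (hi.isEmbedding.injective.ne hpq)).ne')
      (.inl (hle.trans_lt (inducedEDist_ne_top hi.contMDiff p q).lt_top).ne), one_mul]
    exact hle
  · obtain ⟨C, hC⟩ := exists_inducedEDist_le_riemannianEDist hi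
    refine lt_of_le_of_lt (sSup_le ?_) (ENNReal.coe_lt_top (r := C))
    rintro _ ⟨p, q, -, rfl⟩
    exact ENNReal.div_le_of_le_mul (hC (p, q))
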